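/- **NAS-CNF.** Let $\phi$ be a formula in conjunctive normal form over the variables $x_0,\dots,x_{n-1}$, i.e. a finite set of clauses, each a finite set of literals $x_i,\bar x_i$, such that: every clause has at least one and at most three literals; every clause with more than one literal contains a negated and a non-negated literal; every literal appears in at most one clause of size three; and the three literals of a clause of size three belong to three different variables. Let $m$ be the number of clauses of size three. **The point set.** For $0\le i<n$ put $a_i=40i$, $c_i=40i+10$, $b_i=40i+20$, $d_i=40i+30$. The left and right vertical lines of $x_i$ are $x=a_i$ and $x=b_i$, its lower and upper horizontal lines are $y=a_i$ and $y=b_i$. Define finite sets of blue and of red points in $\mathbb{R}^2$ as follows. * *Variable points.* Blue: the four points of $\{a_i,b_i\}\times\{a_i,b_i\}$ for each $i$. Red: for each $i$ the sixteen points of $\{a_i\pm6,b_i\pm6\}\times\{a_i\pm6,b_i\pm6\}$ and the two points $(a_i+3,b_i+6)$, $(b_i+6,b_i-3)$; and for all $i,j$ the four points of $\{c_i,d_i\}\times\{c_j,d_j\}$. * *Equivalence points.* For a clause $x_i$: blue $(a_i,c_i)$, red $(a_i\pm6,c_i)$. For a clause $\bar x_i$: blue $(c_i,a_i)$, red $(c_i,a_i\pm6)$.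 For a clause $x_j\vee\bar x_l$: blue $(a_j,a_l)$, red the four points $(a_j\pm1,a_l\pm1)$. * *Clause and helping points.* For a clause $x_j\vee\bar x_k\vee\bar x_l$ with $k<l$: put $(s,h)=(4,5)$ if $k<j<l$ and $(s,h)=(2,6)$ otherwise; the blue clause points are $(a_j+s,b_k)$ and $(b_j,b_l)$, the blue helping point is $(a_j+h,b_l-6)$, and the red helping point is $(b_j-6,a_l+6)$. For a clause $\bar x_j\vee x_k\vee x_l$ with $k<l$, with the same $s,h$: the blue clause points are $(b_k,b_j-s)$ and $(b_l,a_j)$, the blue helping point is $(b_l-6,b_j-h)$, and the red helping point is $(a_l+6,a_j+6)$. A *blue-rectangle* is a closed non-degenerate axis-aligned rectangle that contains at least one blue point and no red point. **Lemma.** All the blue points can be covered by $2n+m$ blue-rectangles if and only if $\phi$ is satisfiable. -/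

import Mathlib

namespace BCC

/-! ### NAS-CNF formulas -/

/-- A literal over the variables `x_0, …, x_{n-1}`: `(i, true)` is `x_i` and `(i, false)` is the
negation of `x_i`. -/
abbrev Literal (n : ℕ) : Type := Fin n × Bool

/-- A clause, i.e. the disjunction of a finite set of literals. -/
abbrev Clause (n : ℕ) : Type := Finset (Literal n)

/-- A formula in conjunctive normal form, i.e. the conjunction of a finite set of clauses. -/
abbrev CNF (n : ℕ) : Type := Finset (Clause n)

/-- Some truth assignment makes a literal of every clause true. -/
def Satisfiable {n : ℕ} (φ : CNF n) : Prop :=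
  ∃ v : Fin n → Bool, ∀ c ∈ φ, ∃ l ∈ c, v l.1 = l.2

/-- NAS-CNF formulas. -/
structure IsNAS {n : ℕ} (φ : CNF n) : Prop where
  /-- there is no empty clause -/
  nonempty : ∀ c ∈ φ, c.Nonempty
  /-- every clause has at most three literals -/
  card_le : ∀ c ∈ φ, c.card ≤ 3
  /-- every clause with more than one literal has a non-negated and a negated literal -/
  mixed : ∀ c ∈ φ, 1 < c.card → (∃ i, (i, true) ∈ c) ∧ (∃ i, (i, false) ∈ c)
  /-- every literal appears in at most one clause of size three -/
  unique : ∀ l : Literal n, ∀ c ∈ φ, ∀ c' ∈ φ, c.card = 3 → c'.card = 3 →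
    l ∈ c → l ∈ c' → c = c'
  /-- the literals of a clause of size three belong to three different variables -/
  distinct : ∀ c ∈ φ, c.card = 3 → ∀ i, (i, true) ∈ c → (i, false) ∉ c

/-- The number of clauses of size three. -/
def numThree {n : ℕ} (φ : CNF n) : ℕ := (φ.filter fun c => c.card = 3).card

/-! ### Covering blue points by rectangles -/

/-- Axis-aligned (closed, non-degenerate) rectangles. -/
def IsRectangle (S : Set (ℝ × ℝ)) : Prop :=
  ∃ a b c d : ℝ, a < b ∧ c < d ∧ S = Set.Icc a b ×ˢ Set.Icc c d

/-- A blue-rectangle contains blue points and no red point. -/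
def IsBlueRectangle (B R S : Set (ℝ × ℝ)) : Prop :=
  IsRectangle S ∧ (S ∩ B).Nonempty ∧ S ∩ R = ∅

/-- All the points of `B` can be covered by `N` blue-rectangles. -/
def CoverableBy (B R : Set (ℝ × ℝ)) (N : ℕ) : Prop :=
  ∃ T : Finset (Set (ℝ × ℝ)), T.card = N ∧ (∀ S ∈ T, IsBlueRectangle B R S) ∧
    ∀ p ∈ B, ∃ S ∈ T, p ∈ S

/-! ### The point set

All points have integer coordinates.  The variable `x_i` owns the four lines `x = lo i`,
`x = hi i`, `y = lo i`, `y = hi i`; its four blue variable points are the corners of the square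
bounded by these lines, and the squares of the different variables lie along the diagonal.
The vertical (horizontal) *blue strips* of `x_i` are the strips of half-width `6` about its two
vertical (horizontal) lines; the *red strips* are the strips between consecutive blue ones.
A red strip is centred at `mid i` (inside the square of `x_i`) or at `gap i` (between the squares
of `x_i` and `x_{i+1}`). -/

/-- Left vertical line and lower horizontal line of `x_i`. -/
def lo {n : ℕ} (i : Fin n) : ℤ := 40 * (i : ℕ)

/-- Right vertical line and upper horizontal line of `x_i`. -/
def hi {n : ℕ} (i : Fin n) : ℤ := 40 * (i : ℕ) + 20

/-- Centre of the red strip between `lo i` and `hi i`. -/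
def mid {n : ℕ} (i : Fin n) : ℤ := 40 * (i : ℕ) + 10

/-- Centre of the red strip between `hi i` and `lo (i + 1)`. -/
def gap {n : ℕ} (i : Fin n) : ℤ := 40 * (i : ℕ) + 30

/-- The blue variable points: four corners of a square for every variable. -/
def variableBlue (n : ℕ) : Set (ℤ × ℤ) :=
  {p | ∃ i : Fin n, (p.1 = lo i ∨ p.1 = hi i) ∧ (p.2 = lo i ∨ p.2 = hi i)}

/-- The red variable points: four around each blue variable point, at the corners of the crossing
of the two blue strips through it; for each variable two more, one just outside the upper left and
one just outside the upper right blue variable point; and one at each crossing of the centre lines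
of a vertical and a horizontal red strip. -/
def variableRed (n : ℕ) : Set (ℤ × ℤ) :=
  {p | ∃ i : Fin n, (|p.1 - lo i| = 6 ∨ |p.1 - hi i| = 6) ∧ (|p.2 - lo i| = 6 ∨ |p.2 - hi i| = 6)} ∪
  {p | ∃ i : Fin n, p = (lo i + 3, hi i + 6) ∨ p = (hi i + 6, hi i - 3)} ∪
  {p | ∃ i j : Fin n, (p.1 = mid i ∨ p.1 = gap i) ∧ (p.2 = mid j ∨ p.2 = gap j)}

/-- The blue equivalence points.
* For `x_i`: the midpoint of the segment joining the two left variable points of `x_i`.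
* For `¬ x_i`: the midpoint of the segment joining the two lower variable points of `x_i`.
* For `x_j ∨ ¬ x_l`: the intersection of the left vertical line of `x_j` and the lower horizontal
  line of `x_l`. -/
def equivalenceBlue {n : ℕ} (φ : CNF n) : Set (ℤ × ℤ) :=
  {p | ∃ i : Fin n, {(i, true)} ∈ φ ∧ p = (lo i, mid i)} ∪
  {p | ∃ i : Fin n, {(i, false)} ∈ φ ∧ p = (mid i, lo i)} ∪
  {p | ∃ j l : Fin n, {(j, true), (l, false)} ∈ φ ∧ p = (lo j, lo l)}

/-- The red equivalence points: two on the two sides of the blue one for a clause of size one, and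
four around the blue one for a clause of size two. -/
def equivalenceRed {n : ℕ} (φ : CNF n) : Set (ℤ × ℤ) :=
  {p | ∃ i : Fin n, {(i, true)} ∈ φ ∧ |p.1 - lo i| = 6 ∧ p.2 = mid i} ∪
  {p | ∃ i : Fin n, {(i, false)} ∈ φ ∧ p.1 = mid i ∧ |p.2 - lo i| = 6} ∪
  {p | ∃ j l : Fin n, {(j, true), (l, false)} ∈ φ ∧ |p.1 - lo j| = 1 ∧ |p.2 - lo l| = 1}

/-- `φ` has the clause `x_j ∨ ¬ x_k ∨ ¬ x_l`, the upper strip of `x_l` lying above that of `x_k`. -/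
def HasPosClause {n : ℕ} (φ : CNF n) (j k l : Fin n) : Prop :=
  k < l ∧ {(j, true), (k, false), (l, false)} ∈ φ

/-- `φ` has the clause `¬ x_j ∨ x_k ∨ x_l`, the right strip of `x_l` lying to the right of that of
`x_k`. -/
def HasNegClause {n : ℕ} (φ : CNF n) (j k l : Fin n) : Prop :=
  k < l ∧ {(j, false), (k, true), (l, true)} ∈ φ

/-- Distance of the first clause point from the line of `x_j` in whose blue strip it lies. -/
def clauseShift {n : ℕ} (j k l : Fin n) : ℤ := if k < j ∧ j < l then 4 else 2

/-- Distance of the blue helping point from that line.  The helping point is the corner of the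
region formed by two crossing red strips, moved by one unit if `x_j` is between `x_k` and `x_l`. -/
def helpShift {n : ℕ} (j k l : Fin n) : ℤ := if k < j ∧ j < l then 5 else 6

/-- The (blue) clause points.
* For `x_j ∨ ¬ x_k ∨ ¬ x_l`: one in the intersection of the left vertical strip of `x_j` and the
  upper horizontal strip of `x_k`, and one in the intersection of the right vertical strip of `x_j`
  and the upper horizontal strip of `x_l`.
* For `¬ x_j ∨ x_k ∨ x_l`: the same, rotated clockwise by a right angle, so that left, upper, right
  become upper, right, lower. -/
def clauseBlue {n : ℕ} (φ : CNF n) : Set (ℤ × ℤ) :=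
  {p | ∃ j k l : Fin n, HasPosClause φ j k l ∧
    (p = (lo j + clauseShift j k l, hi k) ∨ p = (hi j, hi l))} ∪
  {p | ∃ j k l : Fin n, HasNegClause φ j k l ∧
    (p = (hi k, hi j - clauseShift j k l) ∨ p = (hi l, lo j))}

/-- The blue helping points.  For `x_j ∨ ¬ x_k ∨ ¬ x_l`, the point is at the upper left corner of the
intersection of the first red strip to the right of the left strip of `x_j` and the first red strip
below the upper strip of `x_l`; for `¬ x_j ∨ x_k ∨ x_l`, this is rotated clockwise. -/
def helpingBlue {n : ℕ} (φ : CNF n) : Set (ℤ × ℤ) :=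
  {p | ∃ j k l : Fin n, HasPosClause φ j k l ∧ p = (lo j + helpShift j k l, hi l - 6)} ∪
  {p | ∃ j k l : Fin n, HasNegClause φ j k l ∧ p = (hi l - 6, hi j - helpShift j k l)}

/-- The red helping points, at the opposite corner (lower right, or lower left after the rotation)
of the same region. -/
def helpingRed {n : ℕ} (φ : CNF n) : Set (ℤ × ℤ) :=
  {p | ∃ j k l : Fin n, HasPosClause φ j k l ∧ p = (hi j - 6, lo l + 6)} ∪
  {p | ∃ j k l : Fin n, HasNegClause φ j k l ∧ p = (lo l + 6, lo j + 6)}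

/-- A point with integer coordinates as a point of the plane. -/
def toPlane (p : ℤ × ℤ) : ℝ × ℝ := ((p.1 : ℝ), (p.2 : ℝ))

/-- All blue points of the instance built from `φ`. -/
def bluePoints {n : ℕ} (φ : CNF n) : Set (ℝ × ℝ) :=
  toPlane '' (variableBlue n ∪ equivalenceBlue φ ∪ clauseBlue φ ∪ helpingBlue φ)

/-- All red points of the instance built from `φ`. -/
def redPoints {n : ℕ} (φ : CNF n) : Set (ℝ × ℝ) :=
  toPlane '' (variableRed n ∪ equivalenceRed φ ∪ helpingRed φ)

end BCC

namespace BCC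

/-- The red points as lattice points. -/
def redLattice {n : ℕ} (φ : CNF n) : Set (ℤ × ℤ) :=
  variableRed n ∪ equivalenceRed φ ∪ helpingRed φ

/-- The blue points as lattice points. -/
def blueLattice {n : ℕ} (φ : CNF n) : Set (ℤ × ℤ) :=
  variableBlue n ∪ equivalenceBlue φ ∪ clauseBlue φ ∪ helpingBlue φ

/-- The bounding box of two lattice points contains a red point. -/
def Blocked {n : ℕ} (φ : CNF n) (p q : ℤ × ℤ) : Prop :=
  ∃ r ∈ redLattice φ, (p.1 ≤ r.1 ∧ r.1 ≤ q.1 ∨ q.1 ≤ r.1 ∧ r.1 ≤ p.1) ∧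
    (p.2 ≤ r.2 ∧ r.2 ≤ q.2 ∨ q.2 ≤ r.2 ∧ r.2 ≤ p.2)

theorem IsBlueRectangle.not_blocked {n : ℕ} {φ : CNF n} {B S : Set (ℝ × ℝ)}
    (hS : IsBlueRectangle B (redPoints φ) S) {p q : ℤ × ℤ} (hp : toPlane p ∈ S)
    (hq : toPlane q ∈ S) : ¬ Blocked φ p q := by
  rintro ⟨r, hr, h₁, h₂⟩
  obtain ⟨⟨a, b, c, d, -, -, rfl⟩, -, hR⟩ := hS
  have hmem : toPlane r ∈ redPoints φ := ⟨r, hr, rfl⟩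
  refine Set.eq_empty_iff_forall_notMem.1 hR _ ⟨?_, hmem⟩
  simp only [toPlane, Set.mem_prod, Set.mem_Icc] at hp hq ⊢
  refine ⟨?_, ?_⟩
  · rcases h₁ with ⟨h, h'⟩ | ⟨h, h'⟩
    · exact ⟨hp.1.1.trans (by exact_mod_cast h), le_trans (by exact_mod_cast h') hq.1.2⟩
    · exact ⟨hq.1.1.trans (by exact_mod_cast h), le_trans (by exact_mod_cast h') hp.1.2⟩
  · rcases h₂ with ⟨h, h'⟩ | ⟨h, h'⟩
    · exact ⟨hp.2.1.trans (by exact_mod_cast h), le_trans (by exact_mod_cast h') hq.2.2⟩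
    · exact ⟨hq.2.1.trans (by exact_mod_cast h), le_trans (by exact_mod_cast h') hp.2.2⟩

/-- Coordinates in different cells of width `20` are separated by the centre of a red strip. -/
theorem exists_center {n : ℕ} {x x' : ℤ}
    (h : 0 ≤ x ∧ 0 ≤ x' ∧ x < 40 * n ∧ x' < 40 * n ∧ (x + 10) / 20 ≠ (x' + 10) / 20) :
    ∃ z, (∃ i : Fin n, z = mid i ∨ z = gap i) ∧ (x ≤ z ∧ z ≤ x' ∨ x' ≤ z ∧ z ≤ x) := by
  obtain ⟨t, ht⟩ : ∃ t : ℤ, t = min ((x + 10) / 20) ((x' + 10) / 20) := ⟨_, rfl⟩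
  refine ⟨20 * t + 10, ⟨⟨(t / 2).toNat, by omega⟩, ?_⟩, by omega⟩
  simp only [mid, gap]
  omega

theorem center_mem_redLattice {n : ℕ} (φ : CNF n) {x y : ℤ} (hx : ∃ i : Fin n, x = mid i ∨ x = gap i)
    (hy : ∃ i : Fin n, y = mid i ∨ y = gap i) : (x, y) ∈ redLattice φ := by
  obtain ⟨i, hi⟩ := hx
  obtain ⟨j, hj⟩ := hy
  exact Or.inl (Or.inl (Or.inr ⟨i, j, hi, hj⟩))

theorem blocked_of_cells {n : ℕ} (φ : CNF n) {x y x' y' : ℤ}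
    (hx : 0 ≤ x ∧ 0 ≤ x' ∧ x < 40 * n ∧ x' < 40 * n ∧ (x + 10) / 20 ≠ (x' + 10) / 20)
    (hy : 0 ≤ y ∧ 0 ≤ y' ∧ y < 40 * n ∧ y' < 40 * n ∧ (y + 10) / 20 ≠ (y' + 10) / 20) :
    Blocked φ (x, y) (x', y') := by
  obtain ⟨z, hz, hz'⟩ := exists_center hx
  obtain ⟨w, hw, hw'⟩ := exists_center hy
  exact ⟨(z, w), center_mem_redLattice φ hz hw, hz', hw'⟩

theorem blocked_of_cells_mid_right {n : ℕ} (φ : CNF n) (i : Fin n) {x x' y' : ℤ}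
    (hx : 0 ≤ x ∧ 0 ≤ x' ∧ x < 40 * n ∧ x' < 40 * n ∧ (x + 10) / 20 ≠ (x' + 10) / 20) :
    Blocked φ (x, mid i) (x', y') := by
  obtain ⟨z, hz, hz'⟩ := exists_center hx
  exact ⟨(z, mid i), center_mem_redLattice φ hz ⟨i, Or.inl rfl⟩, hz', by dsimp only; omega⟩

theorem blocked_of_cells_mid_left {n : ℕ} (φ : CNF n) (i : Fin n) {y x' y' : ℤ}
    (hy : 0 ≤ y ∧ 0 ≤ y' ∧ y < 40 * n ∧ y' < 40 * n ∧ (y + 10) / 20 ≠ (y' + 10) / 20) :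
    Blocked φ (mid i, y) (x', y') := by
  obtain ⟨z, hz, hz'⟩ := exists_center hy
  exact ⟨(mid i, z), center_mem_redLattice φ ⟨i, Or.inl rfl⟩ hz, by dsimp only; omega, hz'⟩

/-- The clause `x_j ∨ ¬ x_k ∨ ¬ x_l`. -/
abbrev posClause {n : ℕ} (j k l : Fin n) : Clause n := {(j, true), (k, false), (l, false)}

/-- The clause `¬ x_j ∨ x_k ∨ x_l`. -/
abbrev negClause {n : ℕ} (j k l : Fin n) : Clause n := {(j, false), (k, true), (l, true)}

theorem card_posClause {n : ℕ} {j k l : Fin n} (h : k < l) : (posClause j k l).card = 3 :=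
  Finset.card_eq_three.2 ⟨_, _, _, by simp, by simp, by simp [h.ne], rfl⟩

theorem card_negClause {n : ℕ} {j k l : Fin n} (h : k < l) : (negClause j k l).card = 3 :=
  Finset.card_eq_three.2 ⟨_, _, _, by simp, by simp, by simp [h.ne], rfl⟩

theorem posClause_inj {n : ℕ} {j k l j' k' l' : Fin n} (h : k < l) (h' : k' < l')
    (e : posClause j k l = posClause j' k' l') : j = j' ∧ k = k' ∧ l = l' := by
  have e₁ := Finset.ext_iff.1 e (j, true)
  have e₂ := Finset.ext_iff.1 e (k, false)
  have e₃ := Finset.ext_iff.1 e (l, false)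
  simp at e₁ e₂ e₃
  omega

theorem negClause_inj {n : ℕ} {j k l j' k' l' : Fin n} (h : k < l) (h' : k' < l')
    (e : negClause j k l = negClause j' k' l') : j = j' ∧ k = k' ∧ l = l' := by
  have e₁ := Finset.ext_iff.1 e (j, false)
  have e₂ := Finset.ext_iff.1 e (k, true)
  have e₃ := Finset.ext_iff.1 e (l, true)
  simp at e₁ e₂ e₃
  omega

theorem posClause_ne_negClause {n : ℕ} {j k l j' k' l' : Fin n} (h : k < l) :
    posClause j k l ≠ negClause j' k' l' := by
  intro e
  have e₂ := Finset.ext_iff.1 e (k, false)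
  have e₃ := Finset.ext_iff.1 e (l, false)
  simp at e₂ e₃
  omega

theorem exists_posClause_eq {n : ℕ} (j : Fin n) {k l : Fin n} (h : k ≠ l) :
    ∃ k' l', k' < l' ∧ posClause j k l = posClause j k' l' := by
  rcases lt_or_gt_of_ne h with h | h
  · exact ⟨k, l, h, rfl⟩
  · exact ⟨l, k, h, by rw [posClause, Finset.pair_comm]⟩

theorem exists_negClause_eq {n : ℕ} (j : Fin n) {k l : Fin n} (h : k ≠ l) :
    ∃ k' l', k' < l' ∧ negClause j k l = negClause j k' l' := by
  rcases lt_or_gt_of_ne h with h | h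
  · exact ⟨k, l, h, rfl⟩
  · exact ⟨l, k, h, by rw [negClause, Finset.pair_comm]⟩

theorem IsNAS.eq_posClause_or_eq_negClause {n : ℕ} {φ : CNF n} (hφ : IsNAS φ) {c : Clause n}
    (hc : c ∈ φ) (h3 : c.card = 3) :
    (∃ j k l, k < l ∧ c = posClause j k l) ∨ (∃ j k l, k < l ∧ c = negClause j k l) := by
  obtain ⟨⟨p, hp⟩, ⟨q, hq⟩⟩ := hφ.mixed c hc (by omega)
  obtain ⟨⟨a, s⟩, ⟨b, t⟩, ⟨d, u⟩, hab, had, hbd, rfl⟩ := Finset.card_eq_three.1 h3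
  have pos : ∀ j k l : Fin n, k ≠ l → (∃ j' k' l', k' < l' ∧ posClause j k l = posClause j' k' l') ∨
      ∃ j' k' l', k' < l' ∧ posClause j k l = negClause j' k' l' :=
    fun j k l h => Or.inl ⟨j, exists_posClause_eq j h⟩
  have neg : ∀ j k l : Fin n, k ≠ l → (∃ j' k' l', k' < l' ∧ negClause j k l = posClause j' k' l') ∨
      ∃ j' k' l', k' < l' ∧ negClause j k l = negClause j' k' l' :=
    fun j k l h => Or.inr ⟨j, exists_negClause_eq j h⟩
  cases s <;> cases t <;> cases u <;> simp at hp hq hab had hbd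
  · rw [show ({(a, false), (b, false), (d, true)} : Clause n) = posClause d a b by ext; simp; tauto]
    exact pos d a b hab
  · rw [show ({(a, false), (b, true), (d, false)} : Clause n) = posClause b a d by ext; simp; tauto]
    exact pos b a d had
  · exact neg a b d hbd
  · exact pos a b d hbd
  · rw [show ({(a, true), (b, false), (d, true)} : Clause n) = negClause b a d by ext; simp; tauto]
    exact neg b a d had
  · rw [show ({(a, true), (b, true), (d, false)} : Clause n) = negClause d a b by ext; simp; tauto]
    exact neg d a b hab

theorem IsNAS.posClause_ne {n : ℕ} {φ : CNF n} (hφ : IsNAS φ) {j k l : Fin n} (h : k < l)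
    (hc : posClause j k l ∈ φ) : (j : ℕ) ≠ k ∧ (j : ℕ) ≠ l ∧ (k : ℕ) < l := by
  have h3 := hφ.distinct _ hc (card_posClause h) j (by simp)
  simp [not_or] at h3
  omega

theorem IsNAS.negClause_ne {n : ℕ} {φ : CNF n} (hφ : IsNAS φ) {j k l : Fin n} (h : k < l)
    (hc : negClause j k l ∈ φ) : (j : ℕ) ≠ k ∧ (j : ℕ) ≠ l ∧ (k : ℕ) < l := by
  have h₁ := hφ.distinct _ hc (card_negClause h) k (by simp)
  have h₂ := hφ.distinct _ hc (card_negClause h) l (by simp)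
  simp at h₁ h₂
  omega

/-- Two clauses of size three that share a literal agree. -/
theorem IsNAS.eq_of_mem {n : ℕ} {φ : CNF n} (hφ : IsNAS φ) {c c' : Clause n} (hc : c ∈ φ)
    (hc' : c' ∈ φ) (h : c.card = 3) (h' : c'.card = 3) (l : Literal n) (hl : l ∈ c) (hl' : l ∈ c') :
    c = c' :=
  hφ.unique l c hc c' hc' h h' hl hl'

theorem shift_cases {n : ℕ} (j k l : Fin n) :
    (((k : ℕ) < j ∧ (j : ℕ) < l) ∧ clauseShift j k l = 4 ∧ helpShift j k l = 5) ∨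
      (¬ ((k : ℕ) < j ∧ (j : ℕ) < l) ∧ clauseShift j k l = 2 ∧ helpShift j k l = 6) := by
  unfold clauseShift helpShift
  by_cases h : k < j ∧ j < l
  · exact Or.inl ⟨h, if_pos h, if_pos h⟩
  · exact Or.inr ⟨h, if_neg h, if_neg h⟩

/-- The blue helping point of `x_j ∨ ¬ x_k ∨ ¬ x_l`. -/
def posHelp {n : ℕ} (j k l : Fin n) : ℤ × ℤ := (lo j + helpShift j k l, hi l - 6)

/-- The blue helping point of `¬ x_j ∨ x_k ∨ x_l`. -/
def negHelp {n : ℕ} (j k l : Fin n) : ℤ × ℤ := (hi l - 6, hi j - helpShift j k l)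

/-- `p` is the blue helping point of the clause `c`. -/
def IsHelp {n : ℕ} (c : Clause n) (p : ℤ × ℤ) : Prop :=
  (∃ j k l, k < l ∧ c = posClause j k l ∧ p = posHelp j k l) ∨
    ∃ j k l, k < l ∧ c = negClause j k l ∧ p = negHelp j k l

theorem IsNAS.exists_isHelp {n : ℕ} {φ : CNF n} (hφ : IsNAS φ) {c : Clause n}
    (hc : c ∈ φ) (h3 : c.card = 3) : ∃ p, IsHelp c p := by
  rcases hφ.eq_posClause_or_eq_negClause hc h3 with ⟨j, k, l, h, rfl⟩ | ⟨j, k, l, h, rfl⟩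
  · exact ⟨_, Or.inl ⟨j, k, l, h, rfl, rfl⟩⟩
  · exact ⟨_, Or.inr ⟨j, k, l, h, rfl, rfl⟩⟩

theorem IsHelp.eq_posHelp {n : ℕ} {j k l : Fin n} (h : k < l) {p : ℤ × ℤ}
    (hp : IsHelp (posClause j k l) p) : p = posHelp j k l := by
  rcases hp with ⟨j', k', l', h', e, rfl⟩ | ⟨j', k', l', h', e, rfl⟩
  · obtain ⟨rfl, rfl, rfl⟩ := posClause_inj h h' e
    rfl
  · exact absurd e (posClause_ne_negClause h)

theorem IsHelp.eq_negHelp {n : ℕ} {j k l : Fin n} (h : k < l) {p : ℤ × ℤ}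
    (hp : IsHelp (negClause j k l) p) : p = negHelp j k l := by
  rcases hp with ⟨j', k', l', h', e, rfl⟩ | ⟨j', k', l', h', e, rfl⟩
  · exact absurd e.symm (posClause_ne_negClause h')
  · obtain ⟨rfl, rfl, rfl⟩ := negClause_inj h h' e
    rfl

theorem IsHelp.mem_helpingBlue {n : ℕ} {φ : CNF n} {c : Clause n} (hc : c ∈ φ) {p : ℤ × ℤ}
    (hp : IsHelp c p) : p ∈ helpingBlue φ := by
  rcases hp with ⟨j, k, l, h, rfl, rfl⟩ | ⟨j, k, l, h, rfl, rfl⟩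
  · exact Or.inl ⟨j, k, l, ⟨h, hc⟩, rfl⟩
  · exact Or.inr ⟨j, k, l, ⟨h, hc⟩, rfl⟩

theorem blocked_corner_corner {n : ℕ} (φ : CNF n) {i i' : Fin n} (h : (i : ℕ) ≠ i') {x y x' y' : ℤ}
    (hx : x = lo i ∨ x = hi i) (hy : y = lo i ∨ y = hi i) (hx' : x' = lo i' ∨ x' = hi i')
    (hy' : y' = lo i' ∨ y' = hi i') : Blocked φ (x, y) (x', y') := by
  simp only [lo, hi] at *
  have := i.isLt
  have := i'.isLt
  exact blocked_of_cells φ (by omega) (by omega)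

theorem blocked_diagonal {n : ℕ} (φ : CNF n) (i : Fin n) :
    Blocked φ (lo i, lo i) (hi i, hi i) := by
  have := i.isLt
  exact blocked_of_cells φ (by simp only [lo, hi]; omega) (by simp only [lo, hi]; omega)

theorem blocked_antidiagonal {n : ℕ} (φ : CNF n) (i : Fin n) :
    Blocked φ (lo i, hi i) (hi i, lo i) := by
  have := i.isLt
  exact blocked_of_cells φ (by simp only [lo, hi]; omega) (by simp only [lo, hi]; omega)

theorem crossing_mem_redLattice {n : ℕ} (φ : CNF n) {x y : ℤ} (i : Fin n)
    (hx : x = lo i - 6 ∨ x = lo i + 6 ∨ x = hi i - 6 ∨ x = hi i + 6)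
    (hy : y = lo i - 6 ∨ y = lo i + 6 ∨ y = hi i - 6 ∨ y = hi i + 6) :
    (x, y) ∈ redLattice φ := by
  refine Or.inl (Or.inl (Or.inl (Or.inl ⟨i, ?_, ?_⟩)))
  · rcases hx with rfl | rfl | rfl | rfl <;> simp
  · rcases hy with rfl | rfl | rfl | rfl <;> simp

theorem upper_mem_redLattice {n : ℕ} (φ : CNF n) (i : Fin n) :
    (lo i + 3, hi i + 6) ∈ redLattice φ :=
  Or.inl (Or.inl (Or.inl (Or.inr ⟨i, Or.inl rfl⟩)))

theorem right_mem_redLattice {n : ℕ} (φ : CNF n) (i : Fin n) :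
    (hi i + 6, hi i - 3) ∈ redLattice φ :=
  Or.inl (Or.inl (Or.inl (Or.inr ⟨i, Or.inr rfl⟩)))

theorem blocked_posHelp_corner {n : ℕ} (φ : CNF n) {i j k l : Fin n}
    (hjk : (j : ℕ) ≠ k ∧ (j : ℕ) ≠ l ∧ (k : ℕ) < l) {x y : ℤ}
    (hx : x = lo i ∨ x = hi i) (hy : y = lo i ∨ y = hi i) :
    Blocked φ (posHelp j k l) (x, y) := by
  have hs := shift_cases j k l
  have := i.isLt
  have := j.isLt
  have := l.isLt
  unfold posHelp
  generalize clauseShift j k l = s at hs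
  generalize helpShift j k l = t at hs
  by_cases hc : (x + 10) / 20 ≠ (lo j + 10) / 20 ∧ (y + 10) / 20 ≠ (hi l + 10) / 20
  · simp only [lo, hi] at *
    exact blocked_of_cells φ (by omega) (by omega)
  by_cases hxj : (x + 10) / 20 = (lo j + 10) / 20
  · obtain rfl : i = j := by
      simp only [lo, hi] at *
      omega
    rcases hs with ⟨hs, -, rfl⟩ | ⟨hs, -, rfl⟩
    · exact ⟨_, upper_mem_redLattice φ i, by simp only [lo, hi] at *; omega,
        by simp only [lo, hi] at *; omega⟩
    · rcases lt_or_gt_of_ne hjk.2.1 with h | h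
      · exact ⟨_, crossing_mem_redLattice φ (x := lo i + 6) (y := hi i + 6) i (by simp) (by simp),
          by simp only [lo, hi] at *; omega, by simp only [lo, hi] at *; omega⟩
      · exact ⟨_, crossing_mem_redLattice φ (x := lo i + 6) (y := lo i - 6) i (by simp) (by simp),
          by simp only [lo, hi] at *; omega, by simp only [lo, hi] at *; omega⟩
  · obtain rfl : i = l := by
      simp only [lo, hi] at *
      omega
    rcases lt_or_gt_of_ne hjk.2.1 with h | h
    · exact ⟨_, crossing_mem_redLattice φ (x := lo i - 6) (y := hi i - 6) i (by simp) (by simp),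
        by simp only [lo, hi] at *; omega, by simp only [lo, hi] at *; omega⟩
    · exact ⟨_, crossing_mem_redLattice φ (x := hi i + 6) (y := hi i - 6) i (by simp) (by simp),
        by simp only [lo, hi] at *; omega, by simp only [lo, hi] at *; omega⟩

theorem blocked_negHelp_corner {n : ℕ} (φ : CNF n) {i j k l : Fin n}
    (hjk : (j : ℕ) ≠ k ∧ (j : ℕ) ≠ l ∧ (k : ℕ) < l) {x y : ℤ}
    (hx : x = lo i ∨ x = hi i) (hy : y = lo i ∨ y = hi i) :
    Blocked φ (negHelp j k l) (x, y) := by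
  have hs := shift_cases j k l
  have := i.isLt
  have := j.isLt
  have := l.isLt
  unfold negHelp
  generalize clauseShift j k l = s at hs
  generalize helpShift j k l = t at hs
  by_cases hc : (x + 10) / 20 ≠ (hi l + 10) / 20 ∧ (y + 10) / 20 ≠ (hi j + 10) / 20
  · simp only [lo, hi] at *
    exact blocked_of_cells φ (by omega) (by omega)
  by_cases hyj : (y + 10) / 20 = (hi j + 10) / 20
  · obtain rfl : i = j := by
      simp only [lo, hi] at *
      omega
    rcases hs with ⟨hs, -, rfl⟩ | ⟨hs, -, rfl⟩
    · exact ⟨_, right_mem_redLattice φ i, by simp only [lo, hi] at *; omega,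
        by simp only [lo, hi] at *; omega⟩
    · rcases lt_or_gt_of_ne hjk.2.1 with h | h
      · exact ⟨_, crossing_mem_redLattice φ (x := hi i + 6) (y := hi i - 6) i (by simp) (by simp),
          by simp only [lo, hi] at *; omega, by simp only [lo, hi] at *; omega⟩
      · exact ⟨_, crossing_mem_redLattice φ (x := lo i - 6) (y := hi i - 6) i (by simp) (by simp),
          by simp only [lo, hi] at *; omega, by simp only [lo, hi] at *; omega⟩
  · obtain rfl : i = l := by
      simp only [lo, hi] at *
      omega
    rcases lt_or_gt_of_ne hjk.2.1 with h | h
    · exact ⟨_, crossing_mem_redLattice φ (x := hi i - 6) (y := lo i - 6) i (by simp) (by simp),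
        by simp only [lo, hi] at *; omega, by simp only [lo, hi] at *; omega⟩
    · exact ⟨_, crossing_mem_redLattice φ (x := hi i - 6) (y := hi i + 6) i (by simp) (by simp),
        by simp only [lo, hi] at *; omega, by simp only [lo, hi] at *; omega⟩

theorem IsHelp.blocked_corner {n : ℕ} {φ : CNF n} (hφ : IsNAS φ) {c : Clause n} (hc : c ∈ φ)
    {p : ℤ × ℤ} (hp : IsHelp c p) {i : Fin n} {x y : ℤ}
    (hx : x = lo i ∨ x = hi i) (hy : y = lo i ∨ y = hi i) : Blocked φ p (x, y) := by
  rcases hp with ⟨j, k, l, h, rfl, rfl⟩ | ⟨j, k, l, h, rfl, rfl⟩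
  · exact blocked_posHelp_corner φ (hφ.posClause_ne h hc) hx hy
  · exact blocked_negHelp_corner φ (hφ.negClause_ne h hc) hx hy

/-- If a lattice point lies neither in the column of `posHelp j k l` nor in its row, a red point
separates them. -/
theorem blocked_posHelp {n : ℕ} (φ : CNF n) (j k l : Fin n) {x y : ℤ}
    (hx : 0 ≤ x ∧ x < 40 * n ∧ (x + 10) / 20 ≠ 2 * (j : ℕ))
    (hy : 0 ≤ y ∧ y < 40 * n ∧ (y + 10) / 20 ≠ 2 * (l : ℕ) + 1) :
    Blocked φ (posHelp j k l) (x, y) := by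
  have hs := shift_cases j k l
  have := j.isLt
  have := l.isLt
  unfold posHelp
  exact blocked_of_cells φ (by simp only [lo]; omega) (by simp only [hi]; omega)

theorem blocked_negHelp {n : ℕ} (φ : CNF n) (j k l : Fin n) {x y : ℤ}
    (hx : 0 ≤ x ∧ x < 40 * n ∧ (x + 10) / 20 ≠ 2 * (l : ℕ) + 1)
    (hy : 0 ≤ y ∧ y < 40 * n ∧ (y + 10) / 20 ≠ 2 * (j : ℕ) + 1) :
    Blocked φ (negHelp j k l) (x, y) := by
  have hs := shift_cases j k l
  have := j.isLt
  have := l.isLt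
  unfold negHelp
  exact blocked_of_cells φ (by simp only [hi]; omega) (by simp only [hi]; omega)

/-- A helping point of another clause is separated from a point whose column and row, if they are
those of the helping point, belong to literals of the given clause. -/
theorem IsHelp.blocked_of_ne {n : ℕ} {φ : CNF n} (hφ : IsNAS φ) {c c' : Clause n} (hc : c ∈ φ)
    (hc' : c' ∈ φ) (h3 : c.card = 3) (hne : c ≠ c') {p : ℤ × ℤ} (hp : IsHelp c' p) {x y : ℤ}
    (hx : 0 ≤ x ∧ x < 40 * n) (hy : 0 ≤ y ∧ y < 40 * n)
    (hlo : ∀ i : Fin n, (x + 10) / 20 = 2 * (i : ℕ) → (i, true) ∈ c)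
    (hhi : ∀ i : Fin n, (y + 10) / 20 = 2 * (i : ℕ) + 1 → (i, false) ∈ c)
    (hhi' : ∀ i : Fin n, (x + 10) / 20 = 2 * (i : ℕ) + 1 → (i, true) ∈ c) :
    Blocked φ p (x, y) := by
  rcases hp with ⟨j, k, l, h, rfl, rfl⟩ | ⟨j, k, l, h, rfl, rfl⟩
  · exact blocked_posHelp φ j k l
      ⟨hx.1, hx.2, fun e => hne (hφ.eq_of_mem hc hc' h3 (card_posClause h) _ (hlo j e) (by simp))⟩
      ⟨hy.1, hy.2, fun e => hne (hφ.eq_of_mem hc hc' h3 (card_posClause h) _ (hhi l e) (by simp))⟩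
  · exact blocked_negHelp φ j k l
      ⟨hx.1, hx.2, fun e => hne (hφ.eq_of_mem hc hc' h3 (card_negClause h) _ (hhi' l e) (by simp))⟩
      ⟨hy.1, hy.2, fun e => hne (hφ.eq_of_mem hc hc' h3 (card_negClause h) _ (hhi j e) (by simp))⟩

theorem IsHelp.cells {n : ℕ} {c : Clause n}
    {p : ℤ × ℤ} (hp : IsHelp c p) :
    (0 ≤ p.1 ∧ p.1 < 40 * n) ∧ (0 ≤ p.2 ∧ p.2 < 40 * n) ∧ c.card = 3 ∧
      (∀ i : Fin n, (p.1 + 10) / 20 = 2 * (i : ℕ) → (i, true) ∈ c) ∧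
      (∀ i : Fin n, (p.2 + 10) / 20 = 2 * (i : ℕ) + 1 → (i, false) ∈ c) ∧
      (∀ i : Fin n, (p.1 + 10) / 20 = 2 * (i : ℕ) + 1 → (i, true) ∈ c) := by
  rcases hp with ⟨j, k, l, h, rfl, rfl⟩ | ⟨j, k, l, h, rfl, rfl⟩
  all_goals
    have hs := shift_cases j k l
    have := j.isLt
    have := l.isLt
    simp only [posHelp, negHelp, lo, hi]
  · refine ⟨by omega, by omega, card_posClause h, fun i e => ?_, fun i e => ?_, fun i e => by omega⟩
    · obtain rfl : i = j := by omega
      simp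
    · obtain rfl : i = l := by omega
      simp
  · refine ⟨by omega, by omega, card_negClause h, fun i e => by omega, fun i e => ?_, fun i e => ?_⟩
    · obtain rfl : i = j := by omega
      simp
    · obtain rfl : i = l := by omega
      simp

theorem IsHelp.blocked_isHelp {n : ℕ} {φ : CNF n} (hφ : IsNAS φ) {c c' : Clause n} (hc : c ∈ φ)
    (hc' : c' ∈ φ) (hne : c ≠ c') {p q : ℤ × ℤ} (hp : IsHelp c p) (hq : IsHelp c' q) :
    Blocked φ p q := by
  obtain ⟨hx, hy, h3, h₁, h₂, h₃⟩ := hq.cells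
  exact hp.blocked_of_ne hφ hc' hc h3 hne.symm hx hy h₁ h₂ h₃

/-- An index for every rectangle of a minimum cover: two for every variable, one for every clause
of size three. -/
abbrev CoverIndex {n : ℕ} (φ : CNF n) : Type :=
  (Fin n × Bool) ⊕ {c // c ∈ φ.filter fun c => c.card = 3}

theorem card_coverIndex {n : ℕ} (φ : CNF n) :
    Fintype.card (CoverIndex φ) = 2 * n + numThree φ := by
  rw [Fintype.card_sum, Fintype.card_prod, Fintype.card_coe, Fintype.card_fin, Fintype.card_bool,
    numThree, mul_comm]

/-- In a cover by `2 n + m` rectangles, the two rectangles of every variable are both vertical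
(`v i = true`) or both horizontal (`v i = false`), every other rectangle contains a helping point,
and no helping point is covered twice. -/
theorem exists_orientation {n : ℕ} {φ : CNF n} (hφ : IsNAS φ) {T : Finset (Set (ℝ × ℝ))}
    (hcard : T.card = 2 * n + numThree φ)
    (hT : ∀ S ∈ T, IsBlueRectangle (bluePoints φ) (redPoints φ) S)
    (hcov : ∀ p ∈ blueLattice φ, ∃ S ∈ T, toPlane p ∈ S) :
    ∃ v : Fin n → Bool,
      (∀ S ∈ T,
        (∃ i, v i = true ∧ ∃ x, (x = lo i ∨ x = hi i) ∧ toPlane (x, lo i) ∈ S ∧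
          toPlane (x, hi i) ∈ S) ∨
        (∃ i, v i = false ∧ ∃ y, (y = lo i ∨ y = hi i) ∧ toPlane (lo i, y) ∈ S ∧
          toPlane (hi i, y) ∈ S) ∨
        ∃ c ∈ φ, ∃ p, IsHelp c p ∧ toPlane p ∈ S) ∧
      ∀ c ∈ φ, ∀ p, IsHelp c p → ∀ S ∈ T, ∀ S' ∈ T, toPlane p ∈ S → toPlane p ∈ S' → S = S' := by
  classical
  have hhelp : ∀ c : {c // c ∈ φ.filter fun c => c.card = 3}, ∃ p, IsHelp c.1 p := fun c =>
    hφ.exists_isHelp (Finset.mem_filter.1 c.2).1 (Finset.mem_filter.1 c.2).2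
  choose help hhelp using hhelp
  have hmem : ∀ c : {c // c ∈ φ.filter fun c => c.card = 3}, c.1 ∈ φ :=
    fun c => (Finset.mem_filter.1 c.2).1
  let pt : CoverIndex φ → ℤ × ℤ :=
    Sum.elim (fun a => if a.2 then (hi a.1, hi a.1) else (lo a.1, lo a.1)) help
  have hvar : ∀ (i : Fin n) (x y : ℤ), (x = lo i ∨ x = hi i) → (y = lo i ∨ y = hi i) →
      ∃ S ∈ T, toPlane (x, y) ∈ S := fun i x y hx hy =>
    hcov _ (Or.inl (Or.inl (Or.inl ⟨i, hx, hy⟩)))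
  have hpt : ∀ a, ∃ S ∈ T, toPlane (pt a) ∈ S := by
    rintro (⟨i, _ | _⟩ | c)
    · exact hvar i _ _ (Or.inl rfl) (Or.inl rfl)
    · exact hvar i _ _ (Or.inr rfl) (Or.inr rfl)
    · exact hcov _ (Or.inr ((hhelp c).mem_helpingBlue (hmem c)))
  choose f hfT hf using hpt
  have hsep : ∀ a p q, toPlane p ∈ f a → toPlane q ∈ f a → ¬ Blocked φ p q :=
    fun a p q => (hT _ (hfT a)).not_blocked
  have hcorner : ∀ (i : Fin n) (x y : ℤ), (x = lo i ∨ x = hi i) → (y = lo i ∨ y = hi i) →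
      ∀ a, toPlane (x, y) ∈ f a → a = Sum.inl (i, false) ∨ a = Sum.inl (i, true) := by
    rintro i x y hx hy (⟨i', b⟩ | c) h
    · by_cases hi : (i : ℕ) = i'
      · obtain rfl := Fin.ext hi
        cases b <;> simp
      · refine absurd ?_ (hsep _ _ _ h (hf _))
        cases b
        · exact blocked_corner_corner φ hi hx hy (Or.inl rfl) (Or.inl rfl)
        · exact blocked_corner_corner φ hi hx hy (Or.inr rfl) (Or.inr rfl)
    · exact absurd ((hhelp c).blocked_corner hφ (hmem c) hx hy) (hsep _ _ _ (hf (Sum.inr c)) h)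
  have hinj : Function.Injective f := by
    rintro (⟨i, b⟩ | c) a h
    · have ha : a = Sum.inl (i, false) ∨ a = Sum.inl (i, true) := by
        have := hf (Sum.inl (i, b))
        rw [h] at this
        cases b
        · exact hcorner i _ _ (Or.inl rfl) (Or.inl rfl) a this
        · exact hcorner i _ _ (Or.inr rfl) (Or.inr rfl) a this
      have hd : f (Sum.inl (i, false)) ≠ f (Sum.inl (i, true)) := by
        intro e
        have h₂ := hf (Sum.inl (i, true))
        rw [← e] at h₂
        exact hsep _ _ _ (hf (Sum.inl (i, false))) h₂ (blocked_diagonal φ i)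
      rcases ha with rfl | rfl <;> cases b
      · rfl
      · exact absurd h.symm hd
      · exact absurd h hd
      · rfl
    · rcases a with ⟨i, b⟩ | c'
      · have := hf (Sum.inl (i, b))
        rw [← h] at this
        cases b
        · rcases hcorner i _ _ (Or.inl rfl) (Or.inl rfl) _ this with e | e <;> cases e
        · rcases hcorner i _ _ (Or.inr rfl) (Or.inr rfl) _ this with e | e <;> cases e
      · by_contra hne
        have := hf (Sum.inr c')
        rw [← h] at this
        refine hsep _ _ _ (hf (Sum.inr c)) this ?_
        exact (hhelp c).blocked_isHelp hφ (hmem c) (hmem c')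
          (fun e => hne (congrArg Sum.inr (Subtype.ext e))) (hhelp c')
  have hsurj : ∀ S ∈ T, ∃ a, f a = S := by
    have : Finset.univ.image f = T := by
      refine Finset.eq_of_subset_of_card_le ?_ ?_
      · intro S hS
        obtain ⟨a, -, rfl⟩ := Finset.mem_image.1 hS
        exact hfT a
      · rw [Finset.card_image_of_injective _ hinj, Finset.card_univ, card_coverIndex, hcard]
    intro S hS
    rw [← this] at hS
    obtain ⟨a, -, h⟩ := Finset.mem_image.1 hS
    exact ⟨a, h⟩
  have hcorner' : ∀ (i : Fin n) (x y : ℤ), (x = lo i ∨ x = hi i) → (y = lo i ∨ y = hi i) →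
      toPlane (x, y) ∈ f (Sum.inl (i, false)) ∨ toPlane (x, y) ∈ f (Sum.inl (i, true)) := by
    intro i x y hx hy
    obtain ⟨S, hS, h⟩ := hvar i x y hx hy
    obtain ⟨a, rfl⟩ := hsurj S hS
    rcases hcorner i x y hx hy a h with rfl | rfl
    · exact Or.inl h
    · exact Or.inr h
  refine ⟨fun i => decide (toPlane (lo i, hi i) ∈ f (Sum.inl (i, false))), ?_, ?_⟩
  · intro S hS
    obtain ⟨⟨i, b⟩ | c, rfl⟩ := hsurj S hS
    · by_cases hv : toPlane (lo i, hi i) ∈ f (Sum.inl (i, false))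
      · refine Or.inl ⟨i, by simpa using hv, ?_⟩
        cases b
        · exact ⟨lo i, Or.inl rfl, hf (Sum.inl (i, false)), hv⟩
        · refine ⟨hi i, Or.inr rfl, ?_, hf (Sum.inl (i, true))⟩
          exact (hcorner' i (hi i) (lo i) (Or.inr rfl) (Or.inl rfl)).resolve_left
            fun h => hsep _ _ _ hv h (blocked_antidiagonal φ i)
      · refine Or.inr (Or.inl ⟨i, by simpa using hv, ?_⟩)
        have hu := (hcorner' i (lo i) (hi i) (Or.inl rfl) (Or.inr rfl)).resolve_left hv
        cases b
        · refine ⟨lo i, Or.inl rfl, hf (Sum.inl (i, false)), ?_⟩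
          exact (hcorner' i (hi i) (lo i) (Or.inr rfl) (Or.inl rfl)).resolve_right
            fun h => hsep _ _ _ hu h (blocked_antidiagonal φ i)
        · exact ⟨hi i, Or.inr rfl, hu, hf (Sum.inl (i, true))⟩
    · exact Or.inr (Or.inr ⟨c, hmem c, _, hhelp c, hf (Sum.inr c)⟩)
  · have key : ∀ c ∈ φ, ∀ p, IsHelp c p → ∀ a, toPlane p ∈ f a → ∃ c', a = Sum.inr c' ∧ c'.1 = c := by
      rintro c hc p hp (⟨i, b⟩ | c') h
      · refine absurd ?_ (hsep _ _ _ h (hf _))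
        cases b
        · exact hp.blocked_corner hφ hc (Or.inl rfl) (Or.inl rfl)
        · exact hp.blocked_corner hφ hc (Or.inr rfl) (Or.inr rfl)
      · refine ⟨c', rfl, ?_⟩
        by_contra hne
        exact hsep _ _ _ (hf (Sum.inr c')) h ((hhelp c').blocked_isHelp hφ (hmem c') hc hne hp)
    intro c hc p hp S hS S' hS' h h'
    obtain ⟨a, rfl⟩ := hsurj S hS
    obtain ⟨a', rfl⟩ := hsurj S' hS'
    obtain ⟨c₁, rfl, h₁⟩ := key c hc p hp a h
    obtain ⟨c₂, rfl, h₂⟩ := key c hc p hp a' h'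
    rw [Subtype.ext (h₁.trans h₂.symm)]

/-- The equivalence point of a clause `x_i` is separated from the points outside the left strip of
`x_i`. -/
theorem blocked_of_singleton_true {n : ℕ} {φ : CNF n} {i : Fin n} (hc : {(i, true)} ∈ φ) {x y : ℤ}
    (hx : 0 ≤ x ∧ x < 40 * n)
    (h : (x + 10) / 20 = 2 * (i : ℕ) → x = lo i + 6 ∨
      (x = lo i + 5 ∧ hi i + 6 ≤ y)) : Blocked φ (lo i, mid i) (x, y) := by
  have := i.isLt
  by_cases hxi : (x + 10) / 20 = 2 * (i : ℕ)
  · rcases h hxi with rfl | ⟨rfl, hy⟩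
    · exact ⟨(lo i + 6, mid i), Or.inl (Or.inr (Or.inl (Or.inl ⟨i, hc, by simp, rfl⟩))),
        by dsimp only; omega, by dsimp only; omega⟩
    · exact ⟨_, upper_mem_redLattice φ i, by dsimp only; omega,
        by simp only [lo, hi, mid] at *; omega⟩
  · exact blocked_of_cells_mid_right φ i (by simp only [lo]; omega)

/-- The equivalence point of a clause `x_j ∨ ¬ x_l` is separated from the points off the two lines
through it. -/
theorem blocked_of_equivalence {n : ℕ} {φ : CNF n} {j l : Fin n} (hc : {(j, true), (l, false)} ∈ φ)
    {x y : ℤ} (hx : x ≠ lo j) (hy : y ≠ lo l) : Blocked φ (lo j, lo l) (x, y) := by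
  have hr : ∀ a b : ℤ, |a| = 1 → |b| = 1 → (lo j + a, lo l + b) ∈ redLattice φ := fun a b ha hb =>
    Or.inl (Or.inr (Or.inr ⟨j, l, hc, by simpa using ha, by simpa using hb⟩))
  rcases lt_or_gt_of_ne hx with hx | hx <;> rcases lt_or_gt_of_ne hy with hy | hy
  · exact ⟨_, hr (-1) (-1) (by simp) (by simp), by dsimp only; omega, by dsimp only; omega⟩
  · exact ⟨_, hr (-1) 1 (by simp) (by simp), by dsimp only; omega, by dsimp only; omega⟩
  · exact ⟨_, hr 1 (-1) (by simp) (by simp), by dsimp only; omega, by dsimp only; omega⟩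
  · exact ⟨_, hr 1 1 (by simp) (by simp), by dsimp only; omega, by dsimp only; omega⟩

theorem blocked_posClause {n : ℕ} {φ : CNF n} {j k l : Fin n} (h : HasPosClause φ j k l) :
    Blocked φ (lo j + clauseShift j k l, hi k) (hi j, hi l) := by
  have hs := shift_cases j k l
  have hkl : (k : ℕ) < l := h.1
  exact ⟨_, Or.inr (Or.inl ⟨j, k, l, h, rfl⟩), by simp only [lo, hi]; omega,
    by simp only [lo, hi]; omega⟩

theorem blocked_negClause {n : ℕ} {φ : CNF n} {j k l : Fin n} (h : HasNegClause φ j k l) :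
    Blocked φ (hi k, hi j - clauseShift j k l) (hi l, lo j) := by
  have hs := shift_cases j k l
  have hkl : (k : ℕ) < l := h.1
  exact ⟨_, Or.inr (Or.inr ⟨j, k, l, h, rfl⟩), by simp only [lo, hi]; omega,
    by simp only [lo, hi]; omega⟩

/-- A blue point whose column and row belong to false literals is separated from one of the two
corners in every vertical pair of a true variable and in every horizontal pair of a false one. -/
theorem blocked_or_blocked_of_cells {n : ℕ} (φ : CNF n) {v : Fin n → Bool} {x y : ℤ}
    (hx : 0 ≤ x ∧ x < 40 * n) (hy : 0 ≤ y ∧ y < 40 * n)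
    (hxv : ∀ i : Fin n, (x + 10) / 20 = 2 * (i : ℕ) ∨ (x + 10) / 20 = 2 * (i : ℕ) + 1 → v i = false)
    (hyv : ∀ i : Fin n, (y + 10) / 20 = 2 * (i : ℕ) ∨ (y + 10) / 20 = 2 * (i : ℕ) + 1 → v i = true)
    (i : Fin n) :
    (v i = true → ∀ x', (x' = lo i ∨ x' = hi i) →
      Blocked φ (x, y) (x', lo i) ∨ Blocked φ (x, y) (x', hi i)) ∧
    (v i = false → ∀ y', (y' = lo i ∨ y' = hi i) →
      Blocked φ (x, y) (lo i, y') ∨ Blocked φ (x, y) (hi i, y')) := by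
  have := i.isLt
  have hxi := hxv i
  have hyi := hyv i
  constructor
  · intro hv x' hx'
    simp only [hv, Bool.true_eq_false, imp_false, not_or] at hxi
    by_cases e : (y + 10) / 20 = 2 * (i : ℕ)
    · refine Or.inr (blocked_of_cells φ ?_ ?_) <;> (simp only [lo, hi] at *; omega)
    · refine Or.inl (blocked_of_cells φ ?_ ?_) <;> (simp only [lo, hi] at *; omega)
  · intro hv y' hy'
    simp only [hv, Bool.false_eq_true, imp_false, not_or] at hyi
    by_cases e : (x + 10) / 20 = 2 * (i : ℕ)
    · refine Or.inr (blocked_of_cells φ ?_ ?_) <;> (simp only [lo, hi] at *; omega)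
    · refine Or.inl (blocked_of_cells φ ?_ ?_) <;> (simp only [lo, hi] at *; omega)

theorem satisfiable_of_coverableBy {n : ℕ} {φ : CNF n} (hφ : IsNAS φ)
    (h : CoverableBy (bluePoints φ) (redPoints φ) (2 * n + numThree φ)) : Satisfiable φ := by
  obtain ⟨T, hcard, hT, hcov⟩ := h
  replace hcov : ∀ p ∈ blueLattice φ, ∃ S ∈ T, toPlane p ∈ S := fun p hp => hcov _ ⟨p, hp, rfl⟩
  obtain ⟨v, hv, huniq⟩ := exists_orientation hφ hcard hT hcov
  -- A blue point separated from all variable rectangles lies in a rectangle of a helping point.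
  have hmain : ∀ p ∈ blueLattice φ,
      (∀ i, (v i = true → ∀ x, (x = lo i ∨ x = hi i) →
        Blocked φ p (x, lo i) ∨ Blocked φ p (x, hi i)) ∧
        (v i = false → ∀ y, (y = lo i ∨ y = hi i) →
        Blocked φ p (lo i, y) ∨ Blocked φ p (hi i, y))) →
      ∃ S ∈ T, toPlane p ∈ S ∧ ∃ c ∈ φ, ∃ q, IsHelp c q ∧ toPlane q ∈ S := by
    intro p hp hb
    obtain ⟨S, hS, hpS⟩ := hcov p hp
    refine ⟨S, hS, hpS, ?_⟩
    have hsep : ∀ q, toPlane q ∈ S → ¬ Blocked φ p q := fun q => (hT S hS).not_blocked hpS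
    rcases hv S hS with ⟨i, hi, x, hx, h₁, h₂⟩ | ⟨i, hi, x, hx, h₁, h₂⟩ | h
    · exact (((hb i).1 hi x hx).elim (hsep _ h₁) (hsep _ h₂)).elim
    · exact (((hb i).2 hi x hx).elim (hsep _ h₁) (hsep _ h₂)).elim
    · exact h
  have hmain' : ∀ p ∈ blueLattice φ,
      (∀ i, (v i = true → ∀ x, (x = lo i ∨ x = hi i) →
        Blocked φ p (x, lo i) ∨ Blocked φ p (x, hi i)) ∧
        (v i = false → ∀ y, (y = lo i ∨ y = hi i) →
        Blocked φ p (lo i, y) ∨ Blocked φ p (hi i, y))) →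
      ¬ ∀ c ∈ φ, ∀ q, IsHelp c q → Blocked φ p q := by
    intro p hp hb hq
    obtain ⟨S, hS, hpS, c, hc, q, hcq, hqS⟩ := hmain p hp hb
    exact (hT S hS).not_blocked hpS hqS (hq c hc q hcq)
  refine ⟨v, fun c hc => ?_⟩
  by_contra hu
  push Not at hu
  have hpos := (hφ.nonempty c hc).card_pos
  have hle := hφ.card_le c hc
  have hcases : c.card = 1 ∨ c.card = 2 ∨ c.card = 3 := by omega
  rcases hcases with h1 | h2 | h3
  · obtain ⟨⟨i, b⟩, rfl⟩ := Finset.card_eq_one.1 h1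
    have hvi := hu (i, b) (by simp)
    have hin := i.isLt
    cases b
    · replace hvi : v i = true := by simpa using hvi
      refine hmain' (mid i, lo i) (Or.inl (Or.inl (Or.inr (Or.inl (Or.inr ⟨i, hc, rfl⟩)))))
        (fun i' => ⟨fun hv' x hx => ?_, fun hv' y hy => ?_⟩) ?_
      · have := i'.isLt
        by_cases hii : (i : ℕ) = i'
        · obtain rfl := Fin.ext hii
          right
          exact ⟨(mid i, lo i + 6), Or.inl (Or.inr (Or.inl (Or.inr ⟨i, hc, rfl, by simp⟩))),
            by dsimp only; omega, by simp only [lo, hi]; omega⟩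
        · exact Or.inl (blocked_of_cells_mid_left φ i (by simp only [lo]; omega))
      · have := i'.isLt
        have hii : (i : ℕ) ≠ i' := fun e => by rw [← Fin.ext e, hvi] at hv'; cases hv'
        exact Or.inl (blocked_of_cells_mid_left φ i (by simp only [lo, hi] at *; omega))
      · rintro c' - q (⟨j, k, l, -, -, rfl⟩ | ⟨j, k, l, -, -, rfl⟩)
        all_goals
          have hs := shift_cases j k l
          have := j.isLt
          have := l.isLt
          exact blocked_of_cells_mid_left φ i (by simp only [lo, hi]; omega)
    · replace hvi : v i = false := by simpa using hvi
      refine hmain' (lo i, mid i) (Or.inl (Or.inl (Or.inr (Or.inl (Or.inl ⟨i, hc, rfl⟩)))))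
        (fun i' => ⟨fun hv' x hx => ?_, fun hv' y hy => ?_⟩) ?_
      · have := i'.isLt
        have hii : (i : ℕ) ≠ i' := fun e => by rw [← Fin.ext e, hvi] at hv'; cases hv'
        refine Or.inl (blocked_of_singleton_true hc ?_ ?_) <;> (simp only [lo, hi] at *; omega)
      · have := i'.isLt
        refine Or.inr (blocked_of_singleton_true hc ?_ ?_) <;> (simp only [lo, hi] at *; omega)
      · rintro c' hc' q (⟨j, k, l, h, rfl, rfl⟩ | ⟨j, k, l, -, -, rfl⟩)
        all_goals
          have hs := shift_cases j k l
          have := j.isLt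
          have := l.isLt
          refine blocked_of_singleton_true hc ?_ ?_ <;> (simp only [lo, hi] at *; omega)
  · obtain ⟨⟨j, hj⟩, ⟨l, hl⟩⟩ := hφ.mixed c hc (by omega)
    obtain rfl : {(j, true), (l, false)} = c :=
      Finset.eq_of_subset_of_card_le (by intro x; simp; rintro (rfl | rfl) <;> assumption)
        (by rw [h2, Finset.card_pair (by simp)])
    have hvj : v j = false := by simpa using hu _ hj
    have hvl : v l = true := by simpa using hu _ hl
    refine hmain' (lo j, lo l) (Or.inl (Or.inl (Or.inr (Or.inr ⟨j, l, hc, rfl⟩))))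
      (fun i => ⟨fun hv' x hx => Or.inr ?_, fun hv' y hy => Or.inr ?_⟩) ?_
    · have hij : (i : ℕ) ≠ j := fun e => by rw [Fin.ext e, hvj] at hv'; cases hv'
      refine blocked_of_equivalence hc ?_ ?_ <;> (simp only [lo, hi] at *; omega)
    · have hij : (i : ℕ) ≠ l := fun e => by rw [Fin.ext e, hvl] at hv'; cases hv'
      refine blocked_of_equivalence hc ?_ ?_ <;> (simp only [lo, hi] at *; omega)
    · rintro c' - q (⟨j', k', l', -, -, rfl⟩ | ⟨j', k', l', -, -, rfl⟩)
      all_goals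
        have hs := shift_cases j' k' l'
        refine blocked_of_equivalence hc ?_ ?_ <;> (simp only [lo, hi] at *; omega)
  · -- Both clause points must lie in the rectangle of the helping point of `c`.
    have hclause : ∀ x y, (x, y) ∈ blueLattice φ → (0 ≤ x ∧ x < 40 * n) → (0 ≤ y ∧ y < 40 * n) →
        (∀ i : Fin n, (x + 10) / 20 = 2 * (i : ℕ) ∨ (x + 10) / 20 = 2 * (i : ℕ) + 1 →
          (i, true) ∈ c) →
        (∀ i : Fin n, (y + 10) / 20 = 2 * (i : ℕ) ∨ (y + 10) / 20 = 2 * (i : ℕ) + 1 →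
          (i, false) ∈ c) →
        ∃ S ∈ T, toPlane (x, y) ∈ S ∧ ∃ q, IsHelp c q ∧ toPlane q ∈ S := by
      intro x y hxy hx hy hxc hyc
      obtain ⟨S, hS, hpS, c', hc', q, hcq, hqS⟩ := hmain (x, y) hxy
        (blocked_or_blocked_of_cells φ hx hy (fun i hi => by simpa using hu _ (hxc i hi))
          fun i hi => by simpa using hu _ (hyc i hi))
      by_cases hne : c = c'
      · exact ⟨S, hS, hpS, q, hne ▸ hcq, hqS⟩
      · exact absurd (hcq.blocked_of_ne hφ hc hc' h3 hne hx hy (fun i hi => hxc i (Or.inl hi))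
          (fun i hi => hyc i (Or.inr hi)) fun i hi => hxc i (Or.inr hi))
          ((hT S hS).not_blocked hqS hpS)
    rcases hφ.eq_posClause_or_eq_negClause hc h3 with ⟨j, k, l, h, rfl⟩ | ⟨j, k, l, h, rfl⟩
    all_goals
      have hs := shift_cases j k l
      have := j.isLt
      have := k.isLt
      have := l.isLt
    · obtain ⟨S, hS, hpS, q, hq, hqS⟩ := hclause (lo j + clauseShift j k l) (hi k)
        (Or.inl (Or.inr (Or.inl ⟨j, k, l, ⟨h, hc⟩, Or.inl rfl⟩)))
        (by simp only [lo]; omega) (by simp only [hi]; omega)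
        (fun i e => by
          obtain rfl : i = j := by simp only [lo] at e; omega
          simp)
        (fun i e => by
          obtain rfl : i = k := by simp only [hi] at e; omega
          simp)
      obtain ⟨S', hS', hpS', q', hq', hqS'⟩ := hclause (hi j) (hi l)
        (Or.inl (Or.inr (Or.inl ⟨j, k, l, ⟨h, hc⟩, Or.inr rfl⟩)))
        (by simp only [hi]; omega) (by simp only [hi]; omega)
        (fun i e => by
          obtain rfl : i = j := by simp only [hi] at e; omega
          simp)
        (fun i e => by
          obtain rfl : i = l := by simp only [hi] at e; omega
          simp)
      obtain rfl := (hq.eq_posHelp h).trans (hq'.eq_posHelp h).symm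
      obtain rfl := huniq _ hc _ hq S hS S' hS' hqS hqS'
      exact (hT S hS).not_blocked hpS hpS' (blocked_posClause ⟨h, hc⟩)
    · obtain ⟨S, hS, hpS, q, hq, hqS⟩ := hclause (hi k) (hi j - clauseShift j k l)
        (Or.inl (Or.inr (Or.inr ⟨j, k, l, ⟨h, hc⟩, Or.inl rfl⟩)))
        (by simp only [hi]; omega) (by simp only [hi]; omega)
        (fun i e => by
          obtain rfl : i = k := by simp only [hi] at e; omega
          simp)
        (fun i e => by
          obtain rfl : i = j := by simp only [hi] at e; omega
          simp)
      obtain ⟨S', hS', hpS', q', hq', hqS'⟩ := hclause (hi l) (lo j)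
        (Or.inl (Or.inr (Or.inr ⟨j, k, l, ⟨h, hc⟩, Or.inr rfl⟩)))
        (by simp only [hi]; omega) (by simp only [lo]; omega)
        (fun i e => by
          obtain rfl : i = l := by simp only [hi] at e; omega
          simp)
        (fun i e => by
          obtain rfl : i = j := by simp only [lo] at e; omega
          simp)
      obtain rfl := (hq.eq_negHelp h).trans (hq'.eq_negHelp h).symm
      obtain rfl := huniq _ hc _ hq S hS S' hS' hqS hqS'
      exact (hT S hS).not_blocked hpS hpS' (blocked_negClause ⟨h, hc⟩)

theorem eq_or_eq_of_abs_sub_eq {x a b : ℤ} (h : |x - a| = b) : x = a + b ∨ x = a - b := by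
  rcases abs_cases (x - a) with h' | h' <;> omega

/-- The red points in terms of linear arithmetic. -/
theorem redLattice_cases {n : ℕ} {φ : CNF n} {x y : ℤ} (h : (x, y) ∈ redLattice φ) :
    (∃ i : Fin n, (x = lo i - 6 ∨ x = lo i + 6 ∨ x = hi i - 6 ∨ x = hi i + 6) ∧
      (y = lo i - 6 ∨ y = lo i + 6 ∨ y = hi i - 6 ∨ y = hi i + 6)) ∨
    (∃ i : Fin n, x = lo i + 3 ∧ y = hi i + 6 ∨ x = hi i + 6 ∧ y = hi i - 3) ∨
    (∃ i j : Fin n, (x = mid i ∨ x = gap i) ∧ (y = mid j ∨ y = gap j)) ∨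
    (∃ i : Fin n, (x = lo i + 6 ∨ x = lo i - 6) ∧ y = mid i ∨
      x = mid i ∧ (y = lo i + 6 ∨ y = lo i - 6)) ∨
    (∃ i j : Fin n, (x = lo i + 1 ∨ x = lo i - 1) ∧ (y = lo j + 1 ∨ y = lo j - 1)) ∨
    (∃ j k l : Fin n, HasPosClause φ j k l ∧ x = hi j - 6 ∧ y = lo l + 6) ∨
    (∃ j k l : Fin n, HasNegClause φ j k l ∧ x = lo l + 6 ∧ y = lo j + 6) := by
  rcases h with (((⟨i, h₁, h₂⟩ | ⟨i, h⟩) | ⟨i, j, h⟩) |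
    ((⟨i, -, h₁, h₂⟩ | ⟨i, -, h₁, h₂⟩) | ⟨j, l, -, h₁, h₂⟩)) | (⟨j, k, l, hc, h⟩ | ⟨j, k, l, hc, h⟩)
  · refine Or.inl ⟨i, ?_, ?_⟩
    · rcases h₁ with h | h <;> have := eq_or_eq_of_abs_sub_eq h <;> tauto
    · rcases h₂ with h | h <;> have := eq_or_eq_of_abs_sub_eq h <;> tauto
  · exact Or.inr (Or.inl ⟨i, by simpa using h⟩)
  · exact Or.inr (Or.inr (Or.inl ⟨i, j, h⟩))
  · exact Or.inr (Or.inr (Or.inr (Or.inl ⟨i, Or.inl ⟨eq_or_eq_of_abs_sub_eq h₁, h₂⟩⟩)))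
  · exact Or.inr (Or.inr (Or.inr (Or.inl ⟨i, Or.inr ⟨h₁, eq_or_eq_of_abs_sub_eq h₂⟩⟩)))
  · exact Or.inr (Or.inr (Or.inr (Or.inr (Or.inl
      ⟨j, l, eq_or_eq_of_abs_sub_eq h₁, eq_or_eq_of_abs_sub_eq h₂⟩))))
  · exact Or.inr (Or.inr (Or.inr (Or.inr (Or.inr (Or.inl ⟨j, k, l, hc, by simpa using h⟩)))))
  · exact Or.inr (Or.inr (Or.inr (Or.inr (Or.inr (Or.inr ⟨j, k, l, hc, by simpa using h⟩)))))

/-- No red point lies on a line of a variable. -/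
theorem redLattice_ne {n : ℕ} {φ : CNF n} {x y : ℤ} (h : (x, y) ∈ redLattice φ) :
    x % 20 ≠ 0 ∧ y % 20 ≠ 0 := by
  rcases redLattice_cases h with ⟨i, h⟩ | ⟨i, h⟩ | ⟨i, j, h⟩ | ⟨i, h⟩ | ⟨i, j, h⟩ | ⟨j, k, l, -, h⟩ |
    ⟨j, k, l, -, h⟩ <;> (simp only [lo, hi, mid, gap] at h; omega)

theorem isBlueRectangle_prod {n : ℕ} {φ : CNF n} {a b c d : ℝ} (hab : a < b) (hcd : c < d)
    {p : ℤ × ℤ} (hp : p ∈ blueLattice φ) (hmem : toPlane p ∈ Set.Icc a b ×ˢ Set.Icc c d)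
    (hr : ∀ x y : ℤ, (x, y) ∈ redLattice φ → a ≤ x → x ≤ b → c ≤ y → y ≤ d → False) :
    IsBlueRectangle (bluePoints φ) (redPoints φ) (Set.Icc a b ×ˢ Set.Icc c d) := by
  refine ⟨⟨a, b, c, d, hab, hcd, rfl⟩, ⟨_, hmem, p, hp, rfl⟩, ?_⟩
  refine Set.eq_empty_iff_forall_notMem.2 ?_
  rintro _ ⟨⟨⟨h₁, h₂⟩, h₃, h₄⟩, ⟨x, y⟩, hxy, rfl⟩
  exact hr x y hxy h₁ h₂ h₃ h₄

/-- The rectangle with integral sides `[a, b]` and `[c, d]`. -/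
def latticeRect (a b c d : ℤ) : Set (ℝ × ℝ) :=
  Set.Icc (a : ℝ) b ×ˢ Set.Icc (c : ℝ) d

theorem mem_latticeRect {a b c d x y : ℤ} (hx : a ≤ x ∧ x ≤ b) (hy : c ≤ y ∧ y ≤ d) :
    toPlane (x, y) ∈ latticeRect a b c d := by
  simp only [toPlane, latticeRect, Set.mem_prod, Set.mem_Icc]
  exact_mod_cast And.intro hx hy

theorem isBlueRectangle_latticeRect {n : ℕ} {φ : CNF n} {a b c d x y : ℤ} (hab : a < b)
    (hcd : c < d) (hp : (x, y) ∈ blueLattice φ) (hx : a ≤ x ∧ x ≤ b) (hy : c ≤ y ∧ y ≤ d)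
    (hr : ∀ x y : ℤ, (x, y) ∈ redLattice φ → a ≤ x → x ≤ b → c ≤ y → y ≤ d → False) :
    IsBlueRectangle (bluePoints φ) (redPoints φ) (latticeRect a b c d) :=
  isBlueRectangle_prod (by exact_mod_cast hab) (by exact_mod_cast hcd) hp (mem_latticeRect hx hy)
    fun x y h h₁ h₂ h₃ h₄ => hr x y h (by exact_mod_cast h₁) (by exact_mod_cast h₂)
      (by exact_mod_cast h₃) (by exact_mod_cast h₄)

/-- The strip of width `t` to the right of the line `x = a`. -/
def vertStrip (n : ℕ) (a : ℤ) (t : ℝ) : Set (ℝ × ℝ) :=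
  Set.Icc (a : ℝ) (a + t) ×ˢ Set.Icc 0 (40 * n : ℝ)

/-- The strip of width `1 / 2` above the line `y = a`. -/
def horizStrip (n : ℕ) (a : ℤ) : Set (ℝ × ℝ) :=
  Set.Icc 0 (40 * n : ℝ) ×ˢ Set.Icc (a : ℝ) (a + 1 / 2)

theorem mem_vertStrip {n : ℕ} {a y : ℤ} {t : ℝ} (ht : 0 ≤ t) (hy : 0 ≤ y ∧ y < 40 * n) :
    toPlane (a, y) ∈ vertStrip n a t := by
  simp only [toPlane, vertStrip, Set.mem_prod, Set.mem_Icc]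
  exact ⟨⟨le_rfl, by linarith⟩, by exact_mod_cast hy.1, by exact_mod_cast hy.2.le⟩

theorem mem_horizStrip {n : ℕ} {a x : ℤ} (hx : 0 ≤ x ∧ x < 40 * n) :
    toPlane (x, a) ∈ horizStrip n a := by
  simp only [toPlane, horizStrip, Set.mem_prod, Set.mem_Icc]
  exact ⟨⟨by exact_mod_cast hx.1, by exact_mod_cast hx.2.le⟩, le_rfl, by linarith⟩

theorem corner_mem_blueLattice {n : ℕ} (φ : CNF n) {i : Fin n} {a : ℤ} (ha : a = lo i ∨ a = hi i) :
    (a, a) ∈ blueLattice φ :=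
  Or.inl (Or.inl (Or.inl ⟨i, ha, ha⟩))

theorem isBlueRectangle_vertStrip {n : ℕ} (φ : CNF n) {i : Fin n} {a : ℤ}
    (ha : a = lo i ∨ a = hi i) {t : ℝ} (h0 : 0 < t) (h1 : t < 1) :
    IsBlueRectangle (bluePoints φ) (redPoints φ) (vertStrip n a t) := by
  have hn := i.isLt
  have hn' : (0 : ℝ) < n := by exact_mod_cast i.pos
  refine isBlueRectangle_prod (by linarith) (by linarith) (corner_mem_blueLattice φ ha)
    (mem_vertStrip h0.le (by simp only [lo, hi] at ha; omega)) fun x y h h₁ h₂ _ _ => ?_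
  have h₁' : a ≤ x := by exact_mod_cast h₁
  have h₂' : x < a + 1 := by
    have : (x : ℝ) < a + 1 := by linarith
    exact_mod_cast this
  have := (redLattice_ne h).1
  simp only [lo, hi] at ha
  omega

theorem isBlueRectangle_horizStrip {n : ℕ} (φ : CNF n) {i : Fin n} {a : ℤ}
    (ha : a = lo i ∨ a = hi i) :
    IsBlueRectangle (bluePoints φ) (redPoints φ) (horizStrip n a) := by
  have hn := i.isLt
  have hn' : (0 : ℝ) < n := by exact_mod_cast i.pos
  refine isBlueRectangle_prod (by linarith) (by linarith) (corner_mem_blueLattice φ ha)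
    (mem_horizStrip (by simp only [lo, hi] at ha; omega)) fun x y h _ _ h₁ h₂ => ?_
  have h₁' : a ≤ y := by exact_mod_cast h₁
  have h₂' : y < a + 1 := by
    have : (y : ℝ) < a + 1 := by linarith
    exact_mod_cast this
  have := (redLattice_ne h).2
  simp only [lo, hi] at ha
  omega

theorem infinite_isBlueRectangle {n : ℕ} (φ : CNF n) (i : Fin n) :
    {S | IsBlueRectangle (bluePoints φ) (redPoints φ) S}.Infinite := by
  have ht : ∀ m : ℕ, (0 : ℝ) < 1 / ((m : ℝ) + 2) ∧ 1 / ((m : ℝ) + 2) < 1 := fun m =>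
    ⟨by positivity, by
      rw [div_lt_one (by positivity)]
      linarith [(Nat.cast_nonneg m : (0 : ℝ) ≤ m)]⟩
  refine Set.infinite_of_injective_forall_mem
    (f := fun m : ℕ => vertStrip n (lo i) (1 / ((m : ℝ) + 2))) ?_
    fun m => isBlueRectangle_vertStrip φ (Or.inl rfl) (ht m).1 (ht m).2
  have hle : ∀ m m' : ℕ, vertStrip n (lo i) (1 / ((m : ℝ) + 2)) =
      vertStrip n (lo i) (1 / ((m' : ℝ) + 2)) → m' ≤ m := by
    intro m m' h
    have : ((lo i : ℝ) + 1 / ((m : ℝ) + 2), (0 : ℝ)) ∈ vertStrip n (lo i) (1 / ((m : ℝ) + 2)) :=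
      ⟨⟨by linarith [(ht m).1], le_rfl⟩, le_rfl, by positivity⟩
    rw [h] at this
    have h' := this.1.2
    have h'' : 1 / ((m : ℝ) + 2) ≤ 1 / ((m' : ℝ) + 2) := by simpa using h'
    rw [one_div_le_one_div (by positivity) (by positivity)] at h''
    have : (m' : ℝ) ≤ m := by linarith
    exact_mod_cast this
  exact fun m m' h => le_antisymm (hle m' m h.symm) (hle m m' h)

theorem exists_rectangle_posClause {n : ℕ} {φ : CNF n} (hφ : IsNAS φ) {j k l : Fin n}
    (h : HasPosClause φ j k l) (v : Fin n → Bool)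
    (hv : ∃ a ∈ posClause j k l, v a.1 = a.2) :
    ∃ S, IsBlueRectangle (bluePoints φ) (redPoints φ) S ∧ toPlane (posHelp j k l) ∈ S ∧
      (toPlane (lo j + clauseShift j k l, hi k) ∈ S ∨ v k = false) ∧
      (toPlane (hi j, hi l) ∈ S ∨ v j = true ∨ v l = false) := by
  have hs := shift_cases j k l
  have hne := hφ.posClause_ne h.1 h.2
  have hblue : (lo j + helpShift j k l, hi l - 6) ∈ blueLattice φ := Or.inr (Or.inl ⟨j, k, l, h, rfl⟩)
  unfold posHelp
  by_cases hjl : v j = true ∨ v l = false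
  · refine ⟨latticeRect (lo j + clauseShift j k l) (lo j + helpShift j k l) (hi k) (hi l - 6),
      isBlueRectangle_latticeRect (by omega) (by simp only [hi]; omega) hblue (by omega)
        (by simp only [hi]; omega) ?_, mem_latticeRect (by omega) (by simp only [hi]; omega),
      Or.inl (mem_latticeRect (by omega) (by simp only [hi]; omega)), Or.inr hjl⟩
    intro x y hr h₁ h₂ h₃ h₄
    rcases redLattice_cases hr with ⟨i, hr⟩ | ⟨i, hr⟩ | ⟨i, i', hr⟩ | ⟨i, hr⟩ | ⟨i, i', hr⟩ |
      ⟨j', k', l', hc, hr⟩ | ⟨j', k', l', hc, hr⟩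
    iterate 6
      simp only [lo, hi, mid, gap] at *
      omega
    obtain rfl : l' = j := by
      simp only [lo, hi] at *
      omega
    exact posClause_ne_negClause h.1 (hφ.eq_of_mem h.2 hc.2 (card_posClause h.1)
      (card_negClause hc.1) (l', true) (by simp) (by simp))
  · have hk : v k = false := by
      obtain ⟨a, ha, hva⟩ := hv
      simp only [posClause, Finset.mem_insert, Finset.mem_singleton] at ha
      rcases ha with rfl | rfl | rfl <;> tauto
    refine ⟨latticeRect (lo j + helpShift j k l) (hi j) (hi l - 6) (hi l),
      isBlueRectangle_latticeRect (by simp only [lo, hi]; omega) (by omega) hblue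
        (by simp only [lo, hi]; omega) (by omega) ?_,
        mem_latticeRect (by simp only [lo, hi]; omega) (by omega), Or.inr hk,
      Or.inl (mem_latticeRect (by simp only [lo, hi]; omega) (by omega))⟩
    intro x y hr h₁ h₂ h₃ h₄
    rcases redLattice_cases hr with ⟨i, hr⟩ | ⟨i, hr⟩ | ⟨i, i', hr⟩ | ⟨i, hr⟩ | ⟨i, i', hr⟩ |
      ⟨j', k', l', hc, hr⟩ | ⟨j', k', l', hc, hr⟩ <;>
    (simp only [lo, hi, mid, gap] at *; omega)

theorem exists_rectangle_negClause {n : ℕ} {φ : CNF n} (hφ : IsNAS φ) {j k l : Fin n}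
    (h : HasNegClause φ j k l) (v : Fin n → Bool)
    (hv : ∃ a ∈ negClause j k l, v a.1 = a.2) :
    ∃ S, IsBlueRectangle (bluePoints φ) (redPoints φ) S ∧ toPlane (negHelp j k l) ∈ S ∧
      (toPlane (hi k, hi j - clauseShift j k l) ∈ S ∨ v k = true) ∧
      (toPlane (hi l, lo j) ∈ S ∨ v j = false ∨ v l = true) := by
  have hs := shift_cases j k l
  have hne := hφ.negClause_ne h.1 h.2
  have hblue : (hi l - 6, hi j - helpShift j k l) ∈ blueLattice φ := Or.inr (Or.inr ⟨j, k, l, h, rfl⟩)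
  unfold negHelp
  by_cases hjl : v j = false ∨ v l = true
  · refine ⟨latticeRect (hi k) (hi l - 6) (hi j - helpShift j k l) (hi j - clauseShift j k l),
      isBlueRectangle_latticeRect (by simp only [hi]; omega) (by omega) hblue
        (by simp only [hi]; omega) (by omega) ?_,
        mem_latticeRect (by simp only [hi]; omega) (by omega),
      Or.inl (mem_latticeRect (by simp only [hi]; omega) (by omega)), Or.inr hjl⟩
    intro x y hr h₁ h₂ h₃ h₄
    rcases redLattice_cases hr with ⟨i, hr⟩ | ⟨i, hr⟩ | ⟨i, i', hr⟩ | ⟨i, hr⟩ | ⟨i, i', hr⟩ |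
      ⟨j', k', l', hc, hr⟩ | ⟨j', k', l', hc, hr⟩ <;>
    (simp only [lo, hi, mid, gap] at *; omega)
  · have hk : v k = true := by
      obtain ⟨a, ha, hva⟩ := hv
      simp only [negClause, Finset.mem_insert, Finset.mem_singleton] at ha
      rcases ha with rfl | rfl | rfl <;> tauto
    refine ⟨latticeRect (hi l - 6) (hi l) (lo j) (hi j - helpShift j k l),
      isBlueRectangle_latticeRect (by omega) (by simp only [lo, hi]; omega) hblue (by omega)
        (by simp only [lo, hi]; omega) ?_,
        mem_latticeRect (by omega) (by simp only [lo, hi]; omega), Or.inr hk,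
      Or.inl (mem_latticeRect (by omega) (by simp only [lo, hi]; omega))⟩
    intro x y hr h₁ h₂ h₃ h₄
    rcases redLattice_cases hr with ⟨i, hr⟩ | ⟨i, hr⟩ | ⟨i, i', hr⟩ | ⟨i, hr⟩ | ⟨i, i', hr⟩ |
      ⟨j', k', l', hc, hr⟩ | ⟨j', k', l', hc, hr⟩
    iterate 5
      simp only [lo, hi, mid, gap] at *
      omega
    · obtain rfl : j' = l := by
        simp only [lo, hi] at *
        omega
      exact posClause_ne_negClause hc.1 (hφ.eq_of_mem hc.2 h.2 (card_posClause hc.1)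
        (card_negClause h.1) (j', true) (by simp) (by simp))
    · simp only [lo, hi] at *
      omega

theorem IsNAS.exists_rectangle {n : ℕ} {φ : CNF n} (hφ : IsNAS φ) (v : Fin n → Bool) {c : Clause n}
    (hc : c ∈ φ) (h3 : c.card = 3) (hv : ∃ a ∈ c, v a.1 = a.2) :
    ∃ S, IsBlueRectangle (bluePoints φ) (redPoints φ) S ∧
      (∀ j k l, k < l → c = posClause j k l → toPlane (posHelp j k l) ∈ S ∧
        (toPlane (lo j + clauseShift j k l, hi k) ∈ S ∨ v k = false) ∧
        (toPlane (hi j, hi l) ∈ S ∨ v j = true ∨ v l = false)) ∧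
      ∀ j k l, k < l → c = negClause j k l → toPlane (negHelp j k l) ∈ S ∧
        (toPlane (hi k, hi j - clauseShift j k l) ∈ S ∨ v k = true) ∧
        (toPlane (hi l, lo j) ∈ S ∨ v j = false ∨ v l = true) := by
  rcases hφ.eq_posClause_or_eq_negClause hc h3 with ⟨j, k, l, h, rfl⟩ | ⟨j, k, l, h, rfl⟩
  · obtain ⟨S, hS, hp⟩ := exists_rectangle_posClause hφ ⟨h, hc⟩ v hv
    refine ⟨S, hS, fun j' k' l' h' e => ?_, fun j' k' l' h' e => (posClause_ne_negClause h e).elim⟩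
    obtain ⟨rfl, rfl, rfl⟩ := posClause_inj h h' e
    exact hp
  · obtain ⟨S, hS, hp⟩ := exists_rectangle_negClause hφ ⟨h, hc⟩ v hv
    refine ⟨S, hS, fun j' k' l' h' e => (posClause_ne_negClause h' e.symm).elim,
      fun j' k' l' h' e => ?_⟩
    obtain ⟨rfl, rfl, rfl⟩ := negClause_inj h h' e
    exact hp

/-- A cover by at most the given number of rectangles can be enlarged to one by exactly that
number. -/
theorem coverableBy_of_card_le {n : ℕ} {φ : CNF n} (hφ : IsNAS φ) {T : Finset (Set (ℝ × ℝ))}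
    (hcard : T.card ≤ 2 * n + numThree φ)
    (hT : ∀ S ∈ T, IsBlueRectangle (bluePoints φ) (redPoints φ) S)
    (hcov : ∀ p ∈ bluePoints φ, ∃ S ∈ T, p ∈ S) :
    CoverableBy (bluePoints φ) (redPoints φ) (2 * n + numThree φ) := by
  classical
  rcases Nat.eq_zero_or_pos n with rfl | hn
  · have : numThree φ = 0 := by
      rw [numThree, Finset.card_eq_zero, Finset.filter_eq_empty_iff]
      intro c hc h3
      obtain ⟨a, -⟩ := hφ.nonempty c hc
      exact a.1.elim0
    exact ⟨T, by omega, hT, hcov⟩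
  · have hinf := (infinite_isBlueRectangle φ ⟨0, hn⟩).sdiff T.finite_toSet
    obtain ⟨U, hU, hUc⟩ := hinf.exists_subset_card_eq (2 * n + numThree φ - T.card)
    have hdisj : Disjoint T U := Finset.disjoint_left.2 fun S hS hSU => (hU hSU).2 hS
    refine ⟨T ∪ U, by rw [Finset.card_union_of_disjoint hdisj]; omega, fun S hS => ?_, fun p hp => ?_⟩
    · rcases Finset.mem_union.1 hS with h | h
      · exact hT S h
      · exact (hU h).1
    · obtain ⟨S, hS, h⟩ := hcov p hp
      exact ⟨S, Finset.mem_union_left _ hS, h⟩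

theorem coverableBy_of_satisfiable {n : ℕ} {φ : CNF n} (hφ : IsNAS φ) (h : Satisfiable φ) :
    CoverableBy (bluePoints φ) (redPoints φ) (2 * n + numThree φ) := by
  classical
  obtain ⟨v, hv⟩ := h
  have hE : ∀ c : {c // c ∈ φ.filter fun c => c.card = 3}, _ := fun c =>
    hφ.exists_rectangle v (Finset.mem_filter.1 c.2).1 (Finset.mem_filter.1 c.2).2
      (hv c.1 (Finset.mem_filter.1 c.2).1)
  choose E hblue hpos hneg using hE
  let line : Fin n × Bool → ℤ := fun a => if a.2 then hi a.1 else lo a.1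
  let g : CoverIndex φ → Set (ℝ × ℝ) := Sum.elim
    (fun a => if v a.1 then vertStrip n (line a) (1 / 2) else horizStrip n (line a)) E
  have hline : ∀ a, line a = lo a.1 ∨ line a = hi a.1 := by
    rintro ⟨i, _ | _⟩
    · exact Or.inl rfl
    · exact Or.inr rfl
  have hline' : ∀ i x, x = lo i ∨ x = hi i → ∃ b, line (i, b) = x := by
    rintro i x (rfl | rfl)
    · exact ⟨false, rfl⟩
    · exact ⟨true, rfl⟩
  have hvert : ∀ i, v i = true → ∀ x y, (x = lo i ∨ x = hi i) → 0 ≤ y ∧ y < 40 * (n : ℤ) →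
      ∃ S ∈ Finset.univ.image g, toPlane (x, y) ∈ S := by
    intro i hi x y hx hy
    obtain ⟨b, rfl⟩ := hline' i x hx
    refine ⟨_, Finset.mem_image_of_mem g (Finset.mem_univ (Sum.inl (i, b))), ?_⟩
    simp only [g, Sum.elim_inl, hi, if_true]
    exact mem_vertStrip (by norm_num) hy
  have hhoriz : ∀ i, v i = false → ∀ x y, (y = lo i ∨ y = hi i) → 0 ≤ x ∧ x < 40 * (n : ℤ) →
      ∃ S ∈ Finset.univ.image g, toPlane (x, y) ∈ S := by
    intro i hi x y hy hx
    obtain ⟨b, rfl⟩ := hline' i y hy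
    refine ⟨_, Finset.mem_image_of_mem g (Finset.mem_univ (Sum.inl (i, b))), ?_⟩
    simp only [g, Sum.elim_inl, hi, Bool.false_eq_true, if_false]
    exact mem_horizStrip hx
  have hextra : ∀ c p, (∃ S ∈ Finset.univ.image g, toPlane p ∈ S) ∨ toPlane p ∈ E c →
      ∃ S ∈ Finset.univ.image g, toPlane p ∈ S := by
    rintro c p (h | h)
    · exact h
    · exact ⟨_, Finset.mem_image_of_mem g (Finset.mem_univ (Sum.inr c)), h⟩
  refine coverableBy_of_card_le hφ (T := Finset.univ.image g) ?_ ?_ ?_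
  · rw [← card_coverIndex]
    exact Finset.card_image_le
  · intro S hS
    obtain ⟨⟨i, b⟩ | c, -, rfl⟩ := Finset.mem_image.1 hS
    · cases hvi : v i
      · simp only [g, Sum.elim_inl, hvi, Bool.false_eq_true, if_false]
        exact isBlueRectangle_horizStrip φ (hline _)
      · simp only [g, Sum.elim_inl, hvi, if_true]
        exact isBlueRectangle_vertStrip φ (hline _) (by norm_num) (by norm_num)
    · exact hblue c
  · rintro _ ⟨⟨x, y⟩, hp, rfl⟩
    rcases hp with ((⟨i, hx, hy⟩ | ((⟨i, hc, e⟩ | ⟨i, hc, e⟩) | ⟨j, l, hc, e⟩)) |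
      (⟨j, k, l, hc, e⟩ | ⟨j, k, l, hc, e⟩)) | (⟨j, k, l, hc, e⟩ | ⟨j, k, l, hc, e⟩)
    · have := i.isLt
      dsimp only at hx hy
      cases hvi : v i
      · exact hhoriz i hvi x y hy (by simp only [lo, hi] at hx; omega)
      · exact hvert i hvi x y hx (by simp only [lo, hi] at hy; omega)
    · obtain ⟨rfl, rfl⟩ := Prod.mk.inj e
      have := i.isLt
      obtain ⟨a, ha, hva⟩ := hv _ hc
      rw [Finset.mem_singleton] at ha
      subst ha
      exact hvert i hva _ _ (Or.inl rfl) (by simp only [mid]; omega)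
    · obtain ⟨rfl, rfl⟩ := Prod.mk.inj e
      have := i.isLt
      obtain ⟨a, ha, hva⟩ := hv _ hc
      rw [Finset.mem_singleton] at ha
      subst ha
      exact hhoriz i hva _ _ (Or.inl rfl) (by simp only [mid]; omega)
    · obtain ⟨rfl, rfl⟩ := Prod.mk.inj e
      have := j.isLt
      have := l.isLt
      obtain ⟨a, ha, hva⟩ := hv _ hc
      rw [Finset.mem_insert, Finset.mem_singleton] at ha
      rcases ha with rfl | rfl
      · exact hvert j hva _ _ (Or.inl rfl) (by simp only [lo]; omega)
      · exact hhoriz l hva _ _ (Or.inl rfl) (by simp only [lo]; omega)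
    all_goals
      have := j.isLt
      have := k.isLt
      have := l.isLt
      have hs := shift_cases j k l
    · let c : {c // c ∈ φ.filter fun c => c.card = 3} :=
        ⟨posClause j k l, Finset.mem_filter.2 ⟨hc.2, card_posClause hc.1⟩⟩
      obtain ⟨-, h₁, h₂⟩ := hpos c j k l hc.1 rfl
      refine hextra c _ ?_
      rcases e with e | e <;> obtain ⟨rfl, rfl⟩ := Prod.mk.inj e
      · exact h₁.symm.imp_left fun h =>
          hhoriz k h _ _ (Or.inr rfl) (by simp only [lo]; omega)
      · exact h₂.symm.imp_left fun h => h.elim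
          (fun h => hvert j h _ _ (Or.inr rfl) (by simp only [hi]; omega))
          fun h => hhoriz l h _ _ (Or.inr rfl) (by simp only [hi]; omega)
    · let c : {c // c ∈ φ.filter fun c => c.card = 3} :=
        ⟨negClause j k l, Finset.mem_filter.2 ⟨hc.2, card_negClause hc.1⟩⟩
      obtain ⟨-, h₁, h₂⟩ := hneg c j k l hc.1 rfl
      refine hextra c _ ?_
      rcases e with e | e <;> obtain ⟨rfl, rfl⟩ := Prod.mk.inj e
      · exact h₁.symm.imp_left fun h =>
          hvert k h _ _ (Or.inr rfl) (by simp only [hi]; omega)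
      · exact h₂.symm.imp_left fun h => h.elim
          (fun h => hhoriz j h _ _ (Or.inl rfl) (by simp only [hi]; omega))
          fun h => hvert l h _ _ (Or.inr rfl) (by simp only [lo]; omega)
    · rw [e]
      exact hextra ⟨posClause j k l, Finset.mem_filter.2 ⟨hc.2, card_posClause hc.1⟩⟩ _
        (Or.inr (hpos _ j k l hc.1 rfl).1)
    · rw [e]
      exact hextra ⟨negClause j k l, Finset.mem_filter.2 ⟨hc.2, card_negClause hc.1⟩⟩ _
        (Or.inr (hneg _ j k l hc.1 rfl).1)

end BCC

theorem lemmal (n : ℕ) (φ : BCC.CNF n) (hφ : BCC.IsNAS φ) :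
    BCC.CoverableBy (BCC.bluePoints φ) (BCC.redPoints φ) (2 * n + BCC.numThree φ) ↔
      BCC.Satisfiable φ := by
  exact ⟨BCC.satisfiable_of_coverableBy hφ, BCC.coverableBy_of_satisfiable hφ⟩
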